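/- Let $n,m\ge 1$ be integers and let $0<\alpha<nm$. Cubes $Q\subset\mathbb R^n$ have positive side length and sides parallel to the coordinate axes, $|Q|$ is the Lebesgue measure of $Q$, and a weight is a nonnegative measurable function on $\mathbb R^n$. For measurable $\vec f=(f_1,\dots,f_m)$, $f_i:\mathbb R^n\to\mathbb R$, and measurable $g:\mathbb R^n\to\mathbb R$ put $$\mathcal I_\alpha\vec f(x)=\int_{(\mathbb R^n)^m}\frac{f_1(y_1)\cdots f_m(y_m)}{(|x-y_1|+\dots+|x-y_m|)^{mn-\alpha}}\,d\vec y,\qquad \mathcal M_\alpha\vec f(x)=\sup_{Q\ni x}|Q|^{\alpha/n}\prod_{i=1}^m\frac1{|Q|}\int_Q|f_i|,\qquad Mg(x)=\sup_{Q\ni x}\frac1{|Q|}\int_Q|g|,$$ where $\mathcal M_\alpha\vec f$ and $Mg$ take values in $[0,\infty]$, as does $\mathcal I_\alpha\vec f$ when all $f_i\ge 0$; we write $|\vec f|=(|f_1|,\dots,|f_m|)$. Let $v$ be a weight satisfying the $RH_\infty$ condition: there is a constant $K>0$ such that $\operatorname{ess\,sup}_{Q}v\le\frac K{|Q|}\int_Q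 v$ for every cube $Q$. Then there exists a constant $C>0$ such that for all weights $w_1,\dots,w_m$, with $u=\prod_{i=1}^m w_i^{1/m}$, and all measurable $\vec f=(f_1,\dots,f_m)$, $$\int_{\mathbb R^n}\mathcal I_\alpha|\vec f|(x)\,u(x)\,v(x)\,dx\le C\int_{\mathbb R^n}\mathcal M_\alpha\vec f(x)\,Mu(x)\,v(x)\,dx$$ as an inequality in $[0,\infty]$ (with $0\cdot\infty=0$). In particular, if the right-hand side is finite, then the integral defining $\mathcal I_\alpha\vec f(x)$ converges absolutely for almost every $x$ with $u(x)v(x)\neq0$, the function $\mathcal I_\alpha\vec f\,u\,v$ is integrable, and $$\int_{\mathbb R^n}\mathcal I_\alpha\vec f(x)\,u(x)\,v(x)\,dx\le C\int_{\mathbb R^n}\mathcal M_\alpha\vec f(x)\,Mu(x)\,v(x)\,dx .$$ -/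

import Mathlib

open MeasureTheory
open scoped ENNReal NNReal

noncomputable section

namespace MultiFrac

/-- A weight on `ℝⁿ`: a nonnegative (Lebesgue) measurable function. -/
structure IsWeight {n : ℕ} (w : EuclideanSpace ℝ (Fin n) → ℝ) : Prop where
  aemeasurable : AEMeasurable w volume
  nonneg : ∀ x, 0 ≤ w x

/-- The closed cube with sides parallel to the axes, centre `c` and side length `l`. -/
def cube {n : ℕ} (c : EuclideanSpace ℝ (Fin n)) (l : ℝ) : Set (EuclideanSpace ℝ (Fin n)) :=
  {y | ∀ j, |y j - c j| ≤ l / 2}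

/-- `v` satisfies the `RH_∞` condition: for some positive constant `C`,
`ess sup_Q v ≤ (C / |Q|) ∫_Q v` for every cube `Q` (both sides in `[0, ∞]`). -/
def RHInfty {n : ℕ} (v : EuclideanSpace ℝ (Fin n) → ℝ) : Prop :=
  ∃ C : ℝ≥0, 0 < C ∧ ∀ (c : EuclideanSpace ℝ (Fin n)) (l : ℝ), 0 < l →
    essSup (fun x => ENNReal.ofReal (v x)) (volume.restrict (cube c l)) ≤
      C * ((volume (cube c l))⁻¹ * ∫⁻ y in cube c l, ENNReal.ofReal (v y))

/-- The Hardy-Littlewood maximal function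
`M g (x) = sup_{Q ∋ x} |Q|⁻¹ ∫_Q |g|`, with values in `[0, ∞]`. -/
def hlMaximal {n : ℕ} (g : EuclideanSpace ℝ (Fin n) → ℝ) (x : EuclideanSpace ℝ (Fin n)) :
    ℝ≥0∞ :=
  ⨆ (c : EuclideanSpace ℝ (Fin n)) (l : ℝ) (_ : 0 < l) (_ : x ∈ cube c l),
    (volume (cube c l))⁻¹ * ∫⁻ y in cube c l, ‖g y‖ₑ

/-- The multilinear fractional maximal function
`M_α f (x) = sup_{Q ∋ x} |Q|^{α/n} ∏ᵢ |Q|⁻¹ ∫_Q |fᵢ|`, with values in `[0, ∞]`. -/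
def fracMaximal {n m : ℕ} (α : ℝ) (f : Fin m → EuclideanSpace ℝ (Fin n) → ℝ)
    (x : EuclideanSpace ℝ (Fin n)) : ℝ≥0∞ :=
  ⨆ (c : EuclideanSpace ℝ (Fin n)) (l : ℝ) (_ : 0 < l) (_ : x ∈ cube c l),
    volume (cube c l) ^ (α / n) *
      ∏ i, ((volume (cube c l))⁻¹ * ∫⁻ y in cube c l, ‖f i y‖ₑ)

/-- The integrand
`f₁(y₁) ⋯ fₘ(yₘ) / (|x - y₁| + ⋯ + |x - yₘ|)^{mn - α}` of the multilinear fractional integral. -/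
def fracIntegrand {n m : ℕ} (α : ℝ) (f : Fin m → EuclideanSpace ℝ (Fin n) → ℝ)
    (x : EuclideanSpace ℝ (Fin n)) (y : Fin m → EuclideanSpace ℝ (Fin n)) : ℝ :=
  (∏ i, f i (y i)) / (∑ i, ‖x - y i‖) ^ ((m : ℝ) * n - α)

/-- The multilinear fractional integral `I_α f (x)`, meaningful where it converges absolutely. -/
def fracIntegral {n m : ℕ} (α : ℝ) (f : Fin m → EuclideanSpace ℝ (Fin n) → ℝ)
    (x : EuclideanSpace ℝ (Fin n)) : ℝ :=
  ∫ y, fracIntegrand α f x y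

/-- `I_α (|f₁|, …, |fₘ|) (x)` as an element of `[0, ∞]`; for nonnegative `fᵢ` this is
`I_α f (x)`, with no convergence assumption. -/
def fracIntegralAbs {n m : ℕ} (α : ℝ) (f : Fin m → EuclideanSpace ℝ (Fin n) → ℝ)
    (x : EuclideanSpace ℝ (Fin n)) : ℝ≥0∞ :=
  ∫⁻ y, ‖fracIntegrand α f x y‖ₑ

/-- The geometric mean `u = ∏ᵢ wᵢ^{1/m}` of `m` weights. -/
def geomMean {n m : ℕ} (w : Fin m → EuclideanSpace ℝ (Fin n) → ℝ)
    (x : EuclideanSpace ℝ (Fin n)) : ℝ :=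
  ∏ i, w i x ^ (1 / (m : ℝ))

end MultiFrac

end

open MeasureTheory MultiFrac
open scoped ENNReal NNReal

/-! ### Axis-parallel cubes, the dyadic grid, and a Vitali-type weak estimate. -/

section Cubes

variable {n : ℕ}

/-! The kernel is discretized dyadically and the resulting sum over cubes is made sparse by a
Calderón-Zygmund stopping argument. Splitting according to the dyadic size of `∑ ‖x - y i‖` bounds
the fractional integral at `x` by a constant times the sum of ℓ(3Q)^α ∏ avg_{3Q} |f_i| over the
dyadic cubes Q containing `x` (`fracIntegralAbs_le_tsum`).

Fix a large ratio b. Along the chain of dyadic cubes containing `x`, those whose product of averages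
exceeds b^k all lie inside one maximal cube. Since α > 0, their factors ℓ^α form a geometric series
controlled by that cube (`tsum_scaleFactor_mul_avgProd_le`), so only the maximal cubes of each level
k survive.

On a maximal cube Q, RH_∞ gives ∫_Q uv ≤ K (avg_Q u) ∫_Q v. The next level set fills only a small
fraction of Q (`volume_inter_superLevel_le`), and RH_∞ turns small measure into small v-mass. Hence
the part E_Q of Q outside that level set carries at least half of the v-mass of Q
(`setLIntegral_closedDyadic_le`). On E_Q the number b^k ℓ^α avg_Q u is at most M_α f · Mu, and the
sets E_Q are pairwise disjoint over all levels (`tsum_setLIntegral_exceptionalPart_le`), so summing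
gives the estimate.

Maximal cubes exist when the f_i are integrable. The general case follows by truncating to the
finitely many cubes of a partial sum (`tsum_dyadic_le`). -/

theorem mem_cube {c : EuclideanSpace ℝ (Fin n)} {l : ℝ} {y : EuclideanSpace ℝ (Fin n)} :
    y ∈ cube c l ↔ ∀ j, |y j - c j| ≤ l / 2 := Iff.rfl

theorem measurableSet_cube (c : EuclideanSpace ℝ (Fin n)) (l : ℝ) : MeasurableSet (cube c l) := by
  have : cube c l = ⋂ j, {y | |y j - c j| ≤ l / 2} := by ext y; simp [mem_cube]
  rw [this]
  exact MeasurableSet.iInter fun j => measurableSet_le (by fun_prop) measurable_const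

theorem volume_preimage_ofLp_pi (s : Fin n → Set ℝ) (hs : ∀ i, MeasurableSet (s i)) :
    volume {y : EuclideanSpace ℝ (Fin n) | ∀ i, y i ∈ s i} = ∏ i, volume (s i) := by
  rw [← volume_pi_pi s,
    ← (PiLp.volume_preserving_ofLp (Fin n)).measure_preimage
      (MeasurableSet.univ_pi hs).nullMeasurableSet]
  congr 1
  ext y; simp

theorem volume_cube (c : EuclideanSpace ℝ (Fin n)) (l : ℝ) :
    volume (cube c l) = ENNReal.ofReal l ^ n := by
  have : cube c l = {y | ∀ i, y i ∈ Set.Icc (c i - l / 2) (c i + l / 2)} := by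
    ext y
    simp only [mem_cube, abs_le, Set.mem_ofPred_eq, Set.mem_Icc]
    refine forall_congr' fun i => ?_
    constructor <;> rintro ⟨h₁, h₂⟩ <;> constructor <;> linarith
  rw [this, volume_preimage_ofLp_pi _ fun i => measurableSet_Icc]
  simp [Real.volume_Icc]

theorem volume_cube_ne_zero (c : EuclideanSpace ℝ (Fin n)) {l : ℝ} (hl : 0 < l) :
    volume (cube c l) ≠ 0 := by
  rw [volume_cube]; exact pow_ne_zero _ (by simpa using hl)

theorem volume_cube_ne_top (c : EuclideanSpace ℝ (Fin n)) (l : ℝ) :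
    volume (cube c l) ≠ ∞ := by
  rw [volume_cube]; exact ENNReal.pow_ne_top ENNReal.ofReal_ne_top

/-- The index of the dyadic cube of side length `2 ^ j` that contains `x`. -/
noncomputable def dyadicIndex (j : ℤ) (x : EuclideanSpace ℝ (Fin n)) : Fin n → ℤ :=
  fun i => ⌊x i / 2 ^ j⌋

/-- The half-open dyadic cube of side length `2 ^ j` with index `z`. -/
def dyadicCube (j : ℤ) (z : Fin n → ℤ) : Set (EuclideanSpace ℝ (Fin n)) :=
  {x | dyadicIndex j x = z}

/-- The centre of a dyadic cube. -/
noncomputable def dyadicCenter (j : ℤ) (z : Fin n → ℤ) : EuclideanSpace ℝ (Fin n) :=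
  WithLp.toLp 2 fun i => ((z i : ℝ) + 1 / 2) * 2 ^ j

/-- The closure of a dyadic cube. -/
noncomputable def closedDyadic (j : ℤ) (z : Fin n → ℤ) : Set (EuclideanSpace ℝ (Fin n)) :=
  cube (dyadicCenter j z) (2 ^ j)

/-- The closed threefold dilate of a dyadic cube. -/
noncomputable def tripleDyadic (j : ℤ) (z : Fin n → ℤ) : Set (EuclideanSpace ℝ (Fin n)) :=
  cube (dyadicCenter j z) (3 * 2 ^ j)

theorem mem_dyadicCube {j : ℤ} {z : Fin n → ℤ} {x : EuclideanSpace ℝ (Fin n)} :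
    x ∈ dyadicCube j z ↔ dyadicIndex j x = z := Iff.rfl

theorem mem_dyadicCube_iff_mem_Ico {j : ℤ} {z : Fin n → ℤ} {x : EuclideanSpace ℝ (Fin n)} :
    x ∈ dyadicCube j z ↔ ∀ i, x i ∈ Set.Ico ((z i : ℝ) * 2 ^ j) ((z i + 1) * 2 ^ j) := by
  have h2 : (0 : ℝ) < 2 ^ j := by positivity
  simp only [mem_dyadicCube, dyadicIndex, funext_iff, Int.floor_eq_iff, Set.mem_Ico,
    le_div_iff₀ h2, div_lt_iff₀ h2]

theorem measurable_dyadicIndex (j : ℤ) :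
    Measurable (dyadicIndex j : EuclideanSpace ℝ (Fin n) → Fin n → ℤ) := by
  unfold dyadicIndex
  fun_prop

theorem measurableSet_dyadicCube (j : ℤ) (z : Fin n → ℤ) : MeasurableSet (dyadicCube j z) :=
  measurable_dyadicIndex j (measurableSet_singleton z)

theorem volume_dyadicCube (j : ℤ) (z : Fin n → ℤ) :
    volume (dyadicCube j z) = ENNReal.ofReal (2 ^ j) ^ n := by
  have : dyadicCube j z = {x | ∀ i, x i ∈ Set.Ico ((z i : ℝ) * 2 ^ j) ((z i + 1) * 2 ^ j)} := by
    ext x; exact mem_dyadicCube_iff_mem_Ico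
  rw [this, volume_preimage_ofLp_pi _ fun i => measurableSet_Ico]
  simp only [Real.volume_Ico]
  simp [add_mul]

theorem abs_sub_dyadicCenter_le (j : ℤ) (x : EuclideanSpace ℝ (Fin n)) (i : Fin n) :
    |x i - dyadicCenter j (dyadicIndex j x) i| ≤ 2 ^ j / 2 := by
  have h := mem_dyadicCube_iff_mem_Ico.1 (mem_dyadicCube.2 (rfl : dyadicIndex j x = _)) i
  simp only [dyadicCenter, abs_le]
  constructor <;> linarith [h.1, h.2]

theorem dyadicCube_subset_closedDyadic (j : ℤ) (z : Fin n → ℤ) :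
    dyadicCube j z ⊆ closedDyadic j z := by
  rintro x rfl i
  exact abs_sub_dyadicCenter_le j x i

theorem closedDyadic_subset_tripleDyadic (j : ℤ) (z : Fin n → ℤ) :
    closedDyadic j z ⊆ tripleDyadic j z := by
  intro x hx i
  have := hx i
  have h2 : (0 : ℝ) < 2 ^ j := by positivity
  linarith

theorem volume_closedDyadic (j : ℤ) (z : Fin n → ℤ) :
    volume (closedDyadic j z) = ENNReal.ofReal (2 ^ j) ^ n := volume_cube _ _

theorem volume_tripleDyadic (j : ℤ) (z : Fin n → ℤ) :
    volume (tripleDyadic j z) = ENNReal.ofReal (3 * 2 ^ j) ^ n := volume_cube _ _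

theorem volume_tripleDyadic_ne_zero (j : ℤ) (z : Fin n → ℤ) : volume (tripleDyadic j z) ≠ 0 :=
  volume_cube_ne_zero _ (by positivity)

theorem volume_tripleDyadic_ne_top (j : ℤ) (z : Fin n → ℤ) : volume (tripleDyadic j z) ≠ ∞ :=
  volume_cube_ne_top _ _

theorem volume_tripleDyadic_eq_mul (j : ℤ) (z : Fin n → ℤ) :
    volume (tripleDyadic j z) = 3 ^ n * volume (closedDyadic j z) := by
  rw [volume_tripleDyadic, volume_closedDyadic, ENNReal.ofReal_mul (by norm_num), mul_pow]
  norm_num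

theorem volume_tripleDyadic_succ (j : ℤ) (z z' : Fin n → ℤ) :
    volume (tripleDyadic (j + 1) z') = 2 ^ n * volume (tripleDyadic j z) := by
  rw [volume_tripleDyadic, volume_tripleDyadic, ← ENNReal.ofReal_ofNat 2,
    ← mul_pow, ← ENNReal.ofReal_mul (by norm_num), zpow_add₀ (by norm_num)]
  congr 2; ring

/-- Half-open cubes partition space, while `RHInfty` and the maximal functions use closed cubes;
this lets the two be interchanged. -/
theorem volume_closedDyadic_diff (j : ℤ) (z : Fin n → ℤ) :
    volume (closedDyadic j z \ dyadicCube j z) = 0 := by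
  rw [measure_sdiff (dyadicCube_subset_closedDyadic j z)
    (measurableSet_dyadicCube j z).nullMeasurableSet, volume_dyadicCube, volume_closedDyadic,
    tsub_self]
  rw [volume_dyadicCube]
  exact ENNReal.pow_ne_top ENNReal.ofReal_ne_top

theorem dyadicIndex_eq_of_le {j k : ℤ} (hjk : j ≤ k) {x y : EuclideanSpace ℝ (Fin n)}
    (h : dyadicIndex j x = dyadicIndex j y) : dyadicIndex k x = dyadicIndex k y := by
  obtain ⟨d, rfl⟩ := Int.le.dest hjk
  -- The coarser index is the integer quotient of the finer one by 2^d, which is the nesting of the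
  -- grid.
  have key : ∀ (x : EuclideanSpace ℝ (Fin n)) i,
      dyadicIndex (j + d) x i = dyadicIndex j x i / ((2 ^ d : ℕ) : ℤ) := by
    intro x i
    simp only [dyadicIndex]
    rw [← Int.floor_div_natCast, zpow_add₀ (by norm_num), div_div]
    simp
  ext i
  rw [key, key, h]

theorem tripleDyadic_subset_of_le {j k : ℤ} (hjk : j ≤ k) (x : EuclideanSpace ℝ (Fin n)) :
    tripleDyadic j (dyadicIndex j x) ⊆ tripleDyadic k (dyadicIndex k x) := by
  rcases hjk.eq_or_lt with rfl | hlt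
  · exact subset_rfl
  intro y hy i
  have h₁ := hy i
  have h₂ := abs_sub_dyadicCenter_le j x i
  have h₃ := abs_sub_dyadicCenter_le k x i
  have h₄ : (2 : ℝ) * 2 ^ j ≤ 2 ^ k := by
    rw [mul_comm, ← zpow_add_one₀ (by norm_num)]
    exact zpow_le_zpow_right₀ (by norm_num) hlt
  rw [abs_le] at *
  constructor <;> linarith [h₁.1, h₁.2, h₂.1, h₂.2, h₃.1, h₃.2]

theorem mem_tripleDyadic_of_norm_sub_le {j : ℤ} {x y : EuclideanSpace ℝ (Fin n)}
    (h : ‖x - y‖ ≤ 2 ^ j) : y ∈ tripleDyadic j (dyadicIndex j x) := by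
  intro i
  have h₁ : |x i - y i| ≤ 2 ^ j := by
    simpa using (PiLp.norm_apply_le (x - y) i).trans h
  have h₂ := abs_sub_dyadicCenter_le j x i
  rw [abs_le] at *
  constructor <;> linarith [h₁.1, h₁.2, h₂.1, h₂.2]

/-- Weak type estimate for averages over a family of cubes of bounded size. -/
theorem volume_iUnion_cube_le {ι : Type*} (t : Set ι) (ht : t.Countable)
    (c : ι → EuclideanSpace ℝ (Fin n)) (l : ι → ℝ) (hl : ∀ a ∈ t, 0 < l a) (R : ℝ)
    (hR : ∀ a ∈ t, l a ≤ R) (G : EuclideanSpace ℝ (Fin n) → ℝ≥0∞) (s : ℝ≥0∞)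
    (hG : ∀ a ∈ t, s * volume (cube (c a) (l a)) ≤ ∫⁻ y in cube (c a) (l a), G y) :
    s * volume (⋃ a ∈ t, cube (c a) (l a)) ≤ 5 ^ n * ∫⁻ y, G y := by
  obtain ⟨u, hut, hdisj, hu⟩ := Vitali.exists_disjoint_subfamily_covering_enlargement
    (fun a => cube (c a) (l a)) t l 2 (by norm_num) (fun a ha => (hl a ha).le) R hR
    (fun a ha => ⟨c a, fun j => by simpa using (half_pos (hl a ha)).le⟩)
  have hucount : u.Countable := ht.mono hut
  have hsub : (⋃ a ∈ t, cube (c a) (l a)) ⊆ ⋃ b ∈ u, cube (c b) (5 * l b) := by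
    refine Set.iUnion₂_subset fun a ha y hy => ?_
    obtain ⟨b, hb, ⟨p, hpa, hpb⟩, hab⟩ := hu a ha
    -- With `l a ≤ 2 * l b` and a common point `p`, the distance to `c b` is at most l_a/2 + l_a/2 +
    -- l_b/2 ≤ 5 l_b/2, hence the factor 5.
    refine Set.mem_biUnion hb fun i => ?_
    have h₁ := hy i
    have h₂ := hpa i
    have h₃ := hpb i
    rw [abs_le] at *
    constructor <;> linarith [h₁.1, h₁.2, h₂.1, h₂.2, h₃.1, h₃.2]
  calc s * volume (⋃ a ∈ t, cube (c a) (l a))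
      ≤ s * ∑' b : u, volume (cube (c b) (5 * l b)) := by
        gcongr
        exact (measure_mono hsub).trans (measure_biUnion_le _ hucount _)
    _ = ∑' b : u, 5 ^ n * (s * volume (cube (c b) (l b))) := by
        rw [← ENNReal.tsum_mul_left]
        refine tsum_congr fun b => ?_
        rw [volume_cube, volume_cube, ENNReal.ofReal_mul (by norm_num), mul_pow,
          ENNReal.ofReal_ofNat]
        ring
    _ ≤ ∑' b : u, 5 ^ n * ∫⁻ y in cube (c b) (l b), G y :=
        ENNReal.tsum_le_tsum fun b => by gcongr; exact hG b (hut b.2)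
    _ = 5 ^ n * ∫⁻ y in ⋃ b ∈ u, cube (c b) (l b), G y := by
        rw [ENNReal.tsum_mul_left, lintegral_biUnion hucount (fun b _ => measurableSet_cube _ _)
          hdisj]
    _ ≤ 5 ^ n * ∫⁻ y, G y := by gcongr; exact Measure.restrict_le_self

end Cubes

/-! ### Tonelli for products of one-variable functions. -/

theorem lintegral_fin_prod_eq_prod {E : Type*} [MeasureSpace E] [SigmaFinite (volume : Measure E)]
    {m : ℕ} (g : Fin m → E → ℝ≥0∞) (hg : ∀ i, AEMeasurable (g i) volume) :
    ∫⁻ y : Fin m → E, ∏ i, g i (y i) = ∏ i, ∫⁻ x, g i x := by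
  induction m with
  | zero => simp [volume_pi]
  | succ k ih =>
    have hm : ∀ i, AEMeasurable (fun y : Fin k → E => g (Fin.succ i) (y i)) volume := fun i =>
      (hg _).comp_quasiMeasurePreserving (Measure.quasiMeasurePreserving_eval _ i)
    calc ∫⁻ y : Fin (k + 1) → E, ∏ i, g i (y i)
        = ∫⁻ p : E × (Fin k → E), g 0 p.1 * ∏ i : Fin k, g (Fin.succ i) (p.2 i) := by
          have h := ((measurePreserving_piFinSuccAbove
            (fun _ : Fin (k + 1) => (volume : Measure E)) 0).symm).lintegral_comp_emb
              (MeasurableEquiv.measurableEmbedding _) (fun y => ∏ i, g i (y i))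
          rw [volume_pi, ← h]
          refine lintegral_congr fun p => ?_
          rw [Fin.prod_univ_succ]
          rfl
      _ = (∫⁻ x, g 0 x) * ∏ i : Fin k, ∫⁻ x, g (Fin.succ i) x := by
          rw [← ih _ fun i => hg _, ← lintegral_prod_mul (hg 0)
            (Finset.aemeasurable_fun_prod _ fun i _ => hm i)]
          rfl
      _ = ∏ i, ∫⁻ x, g i x := (Fin.prod_univ_succ fun i => ∫⁻ x, g i x).symm

/-! ### Dyadic discretization of the fractional kernel. -/

section Kernel

variable {n m : ℕ}

/-- The product of the averages of the `F i` over the threefold dilate of a dyadic cube. -/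
noncomputable def avgProd (F : Fin m → EuclideanSpace ℝ (Fin n) → ℝ≥0∞) (j : ℤ)
    (z : Fin n → ℤ) : ℝ≥0∞ :=
  ∏ i, ((volume (tripleDyadic j z))⁻¹ * ∫⁻ y in tripleDyadic j z, F i y)

/-- The power `ℓ ^ α` of the side length `ℓ` of the threefold dilates of generation `j`. -/
noncomputable def scaleFactor (α : ℝ) (j : ℤ) : ℝ≥0∞ := ENNReal.ofReal ((3 * 2 ^ j) ^ α)

theorem measurableSet_tripleDyadic (j : ℤ) (z : Fin n → ℤ) : MeasurableSet (tripleDyadic j z) :=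
  measurableSet_cube _ _

theorem enorm_fracIntegrand_le {α : ℝ} (hα : α < n * m)
    (f : Fin m → EuclideanSpace ℝ (Fin n) → ℝ) (x : EuclideanSpace ℝ (Fin n))
    (y : Fin m → EuclideanSpace ℝ (Fin n)) :
    ‖fracIntegrand α f x y‖ₑ ≤ ∑' j : ℤ, ENNReal.ofReal ((2 ^ (j - 1)) ^ (-((m : ℝ) * n - α))) *
      ∏ i, (tripleDyadic j (dyadicIndex j x)).indicator (fun t => ‖f i t‖ₑ) (y i) := by
  have hβ : 0 < (m : ℝ) * n - α := by linarith [mul_comm (m : ℝ) n]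
  set s := ∑ i, ‖x - y i‖ with hs
  have hs0 : 0 ≤ s := Finset.sum_nonneg fun i _ => norm_nonneg _
  unfold fracIntegrand
  rw [← hs]
  -- At the singularity the denominator is zero to a positive power, so the quotient is 0 by
  -- convention.
  rcases hs0.eq_or_lt with h0 | hpos
  · rw [← h0, Real.zero_rpow hβ.ne']; simp
  -- With 2^k < s ≤ 2^(k+1), the single term j = k + 1 suffices: the upper bound puts every `y i` in
  -- the tripled cube, the lower bound controls the kernel.
  obtain ⟨k, hk1, hk2⟩ := exists_mem_Ioc_zpow hpos (one_lt_two : (1 : ℝ) < 2)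
  refine le_trans ?_ (ENNReal.le_tsum (k + 1))
  have hmem : ∀ i, y i ∈ tripleDyadic (k + 1) (dyadicIndex (k + 1) x) := fun i =>
    mem_tripleDyadic_of_norm_sub_le
      ((Finset.single_le_sum (f := fun i => ‖x - y i‖) (fun i _ => norm_nonneg _)
        (Finset.mem_univ i)).trans hk2)
  simp only [Set.indicator_of_mem (hmem _)]
  rw [div_eq_mul_inv, enorm_mul, mul_comm, ← Real.rpow_neg hs0,
    Real.enorm_of_nonneg (Real.rpow_nonneg hs0 _)]
  have : ‖∏ i, f i (y i)‖ₑ = ∏ i, ‖f i (y i)‖ₑ := by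
    simp [enorm_eq_nnnorm, nnnorm_prod]
  rw [this, add_sub_cancel_right]
  gcongr ENNReal.ofReal ?_ * _
  exact Real.rpow_le_rpow_of_nonpos (by positivity) hk1.le (by linarith)

theorem fracIntegralAbs_le_tsum {α : ℝ} (hα : α < n * m)
    (f : Fin m → EuclideanSpace ℝ (Fin n) → ℝ) (hf : ∀ i, AEMeasurable (f i) volume)
    (x : EuclideanSpace ℝ (Fin n)) :
    fracIntegralAbs α f x ≤ ENNReal.ofReal (6 ^ ((m : ℝ) * n - α)) *
      ∑' j : ℤ, scaleFactor α j * avgProd (fun i y => ‖f i y‖ₑ) j (dyadicIndex j x) := by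
  have hmeas : ∀ (j : ℤ) i, AEMeasurable ((tripleDyadic j (dyadicIndex j x)).indicator
      (fun t => ‖f i t‖ₑ)) volume := fun j i =>
    (hf i).enorm.indicator (measurableSet_tripleDyadic _ _)
  have hprod : ∀ j : ℤ, AEMeasurable (fun y : Fin m → EuclideanSpace ℝ (Fin n) =>
      ENNReal.ofReal ((2 ^ (j - 1)) ^ (-((m : ℝ) * n - α))) *
        ∏ i, (tripleDyadic j (dyadicIndex j x)).indicator (fun t => ‖f i t‖ₑ) (y i)) volume :=
    fun j => (Finset.aemeasurable_fun_prod _ fun i _ =>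
      (hmeas j i).comp_quasiMeasurePreserving
        (Measure.quasiMeasurePreserving_eval _ i)).const_mul _
  refine (lintegral_mono fun y => enorm_fracIntegrand_le hα f x y).trans ?_
  rw [lintegral_tsum hprod, ← ENNReal.tsum_mul_left]
  refine le_of_eq (tsum_congr fun j => ?_)
  rw [lintegral_const_mul' _ _ ENNReal.ofReal_ne_top, lintegral_fin_prod_eq_prod _ (hmeas j)]
  simp only [lintegral_indicator (measurableSet_tripleDyadic _ _)]
  unfold avgProd scaleFactor
  rw [Finset.prod_mul_distrib, ← mul_assoc, ← mul_assoc]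
  congr 1
  have h2 : (0 : ℝ) < 2 ^ j := by positivity
  have h3 : (0 : ℝ) < 3 * 2 ^ j := by positivity
  rw [Finset.prod_const, volume_tripleDyadic, Finset.card_univ, Fintype.card_fin,
    ← ENNReal.ofReal_pow h3.le, ← ENNReal.ofReal_inv_of_pos (by positivity),
    ← ENNReal.ofReal_pow (by positivity), ← ENNReal.ofReal_mul (by positivity),
    ← ENNReal.ofReal_mul (by positivity)]
  congr 1
  -- Rewriting in terms of the side 3·2^j of the tripled cube produces the constant 6^(mn-α); the
  -- factor side^(-mn) is absorbed by the `m` averages.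
  have e1 : (2 : ℝ) ^ (j - 1) = (3 * 2 ^ j) / 6 := by
    rw [zpow_sub_one₀ (by norm_num)]; ring
  rw [e1, Real.div_rpow h3.le (by norm_num), Real.rpow_neg (by norm_num : (0 : ℝ) ≤ 6), div_inv_eq_mul,
    neg_sub, Real.rpow_sub h3, inv_pow, ← pow_mul, ← Real.rpow_natCast _ (n * m)]
  push_cast
  rw [mul_comm (n : ℝ) m]
  field_simp

end Kernel

/-! ### Maximal dyadic cubes, geometric summation and sparseness. -/

section Discrete

variable {n m : ℕ}

theorem iUnion_dyadicCube (j : ℤ) :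
    (⋃ z, dyadicCube j z) = (Set.univ : Set (EuclideanSpace ℝ (Fin n))) :=
  Set.eq_univ_of_forall fun x => Set.mem_iUnion.2 ⟨dyadicIndex j x, rfl⟩

theorem pairwise_disjoint_dyadicCube (j : ℤ) :
    Pairwise (Function.onFun Disjoint
      (dyadicCube j : (Fin n → ℤ) → Set (EuclideanSpace ℝ (Fin n)))) := by
  intro z z' hz
  rw [Function.onFun, Set.disjoint_left]
  rintro x rfl h
  exact hz h

/-- Passes between sums along the chain of cubes containing a point and sums over the whole grid:
each generation partitions space. -/
theorem lintegral_tsum_dyadicIndex (c : ℤ → (Fin n → ℤ) → ℝ≥0∞)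
    {h : EuclideanSpace ℝ (Fin n) → ℝ≥0∞} (hh : AEMeasurable h volume) :
    ∫⁻ x, (∑' j, c j (dyadicIndex j x)) * h x = ∑' j, ∑' z, c j z * ∫⁻ x in dyadicCube j z, h x := by
  have hc : ∀ j, Measurable fun x : EuclideanSpace ℝ (Fin n) => c j (dyadicIndex j x) := fun j =>
    (measurable_of_countable (c j)).comp (measurable_dyadicIndex j)
  simp_rw [← ENNReal.tsum_mul_right]
  rw [lintegral_tsum (f := fun j x => c j (dyadicIndex j x) * h x)
    fun j => (hc j).aemeasurable.mul hh]
  refine tsum_congr fun j => ?_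
  rw [← setLIntegral_univ, ← iUnion_dyadicCube j,
    lintegral_iUnion (measurableSet_dyadicCube j) (pairwise_disjoint_dyadicCube j)]
  refine tsum_congr fun z => ?_
  rw [← lintegral_const_mul'' _ hh.restrict]
  refine setLIntegral_congr_fun (measurableSet_dyadicCube j z) ?_
  rintro x rfl
  rfl

/-- The set where some dyadic cube has averages with product exceeding `t`. -/
def superLevel (F : Fin m → EuclideanSpace ℝ (Fin n) → ℝ≥0∞) (t : ℝ≥0∞) :
    Set (EuclideanSpace ℝ (Fin n)) :=
  {x | ∃ j, t < avgProd F j (dyadicIndex j x)}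

theorem measurableSet_superLevel (F : Fin m → EuclideanSpace ℝ (Fin n) → ℝ≥0∞) (t : ℝ≥0∞) :
    MeasurableSet (superLevel F t) := by
  have : superLevel F t = ⋃ j, {x | t < avgProd F j (dyadicIndex j x)} := by
    ext x; simp [superLevel]
  rw [this]
  exact MeasurableSet.iUnion fun j => measurableSet_lt measurable_const
    ((measurable_of_countable (avgProd F j)).comp (measurable_dyadicIndex j))

/-- A dyadic cube that is maximal among those whose product of averages exceeds `t`. -/
def IsMaximalCube (F : Fin m → EuclideanSpace ℝ (Fin n) → ℝ≥0∞) (t : ℝ≥0∞) (j : ℤ)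
    (z : Fin n → ℤ) : Prop :=
  t < avgProd F j z ∧ ∀ x ∈ dyadicCube j z, ∀ k, j < k → avgProd F k (dyadicIndex k x) ≤ t

/-- With finite total masses, averages over cubes of side q decay at least like 1/q once q ≥ 1. This
makes maximal cubes exist at every positive level. -/
theorem exists_avgProd_le (hn : 0 < n) (hm : 0 < m)
    {F : Fin m → EuclideanSpace ℝ (Fin n) → ℝ≥0∞} (hF : ∀ i, ∫⁻ x, F i x ≠ ∞) {t : ℝ≥0∞}
    (ht : t ≠ 0) : ∃ J : ℤ, ∀ j, J ≤ j → ∀ z, avgProd F j z ≤ t := by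
  have hA : ∏ i, ∫⁻ x, F i x ≠ ∞ := ENNReal.prod_ne_top fun i _ => hF i
  obtain ⟨N, hN⟩ := ENNReal.exists_nat_gt (ENNReal.div_lt_top hA ht).ne
  refine ⟨N, fun j hj z => ?_⟩
  set q : ℝ≥0∞ := ENNReal.ofReal (3 * 2 ^ j) with hq
  have hNq : (N : ℝ≥0∞) ≤ q := by
    rw [hq, ← ENNReal.ofReal_natCast]
    refine ENNReal.ofReal_le_ofReal ?_
    have h₁ : (N : ℝ) ≤ 2 ^ N := by exact_mod_cast Nat.lt_two_pow_self.le
    have h₂ : (2 : ℝ) ^ (N : ℤ) ≤ 2 ^ j := zpow_le_zpow_right₀ (by norm_num) hj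
    rw [zpow_natCast] at h₂
    linarith [zpow_pos (two_pos : (0 : ℝ) < 2) j]
  have hq1 : 1 ≤ q := by
    rw [hq, ← ENNReal.ofReal_one]
    refine ENNReal.ofReal_le_ofReal ?_
    have : (1 : ℝ) ≤ 2 ^ j := one_le_zpow₀ (by norm_num) (by omega)
    linarith
  have hqtop : q ≠ ∞ := ENNReal.ofReal_ne_top
  have hqp : q ≤ (q ^ n) ^ m := by
    rw [← pow_mul]; exact le_self_pow₀ hq1 (Nat.mul_pos hn hm).ne'
  calc avgProd F j z
      ≤ ∏ i, ((q ^ n)⁻¹ * ∫⁻ x, F i x) := by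
        unfold avgProd
        rw [volume_tripleDyadic]
        gcongr
        exact Measure.restrict_le_self
    _ = ((q ^ n) ^ m)⁻¹ * ∏ i, ∫⁻ x, F i x := by
        rw [Finset.prod_mul_distrib, Finset.prod_const, Finset.card_univ, Fintype.card_fin,
          ENNReal.inv_pow, ENNReal.inv_pow, ENNReal.inv_pow]
    _ ≤ q⁻¹ * ∏ i, ∫⁻ x, F i x := by gcongr
    _ ≤ t := by
        rw [mul_comm, ← div_eq_mul_inv]
        refine ENNReal.div_le_of_le_mul ?_
        rw [mul_comm]
        exact (ENNReal.div_le_iff_le_mul (Or.inl ht) (Or.inr (zero_lt_one.trans_le hq1).ne')).1 (hN.le.trans hNq)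

theorem avgProd_ne_top {F : Fin m → EuclideanSpace ℝ (Fin n) → ℝ≥0∞}
    (hF : ∀ i, ∫⁻ x, F i x ≠ ∞) (j : ℤ) (z : Fin n → ℤ) : avgProd F j z ≠ ∞ :=
  ENNReal.prod_ne_top fun i _ => ENNReal.mul_ne_top
    (ENNReal.inv_ne_top.2 (volume_tripleDyadic_ne_zero j z))
    (ne_top_of_le_ne_top (hF i) (setLIntegral_le_lintegral _ _))

theorem scaleFactor_sub (α : ℝ) (j : ℤ) (i : ℕ) :
    scaleFactor α (j - i) = scaleFactor α j * ENNReal.ofReal (2 ^ (-α)) ^ i := by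
  have h2 : (0 : ℝ) < 2 ^ j := by positivity
  unfold scaleFactor
  rw [← ENNReal.ofReal_pow (by positivity), ← ENNReal.ofReal_mul (by positivity)]
  congr 1
  rw [← Real.rpow_natCast, ← Real.rpow_mul (by norm_num), zpow_sub₀ (by norm_num), zpow_natCast,
    ← Real.rpow_natCast, ← mul_div_assoc, Real.div_rpow (by positivity) (by positivity),
    ← Real.rpow_mul (by norm_num), div_eq_mul_inv, ← Real.rpow_neg (by norm_num)]
  congr 2; ring

/-- The sum of the geometric series of ratio `2 ^ (-α)`. -/
noncomputable def geomConst (α : ℝ) : ℝ≥0∞ := (1 - ENNReal.ofReal (2 ^ (-α)))⁻¹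

theorem geomConst_ne_top {α : ℝ} (hα : 0 < α) : geomConst α ≠ ∞ := by
  unfold geomConst
  rw [ENNReal.inv_ne_top]
  refine (tsub_pos_of_lt ?_).ne'
  rw [ENNReal.ofReal_lt_one]
  exact Real.rpow_lt_one_of_one_lt_of_neg (by norm_num) (by linarith)

theorem tsum_scaleFactor_le (α : ℝ) (s : Set ℤ) (J : ℤ) (hs : ∀ j ∈ s, j ≤ J) :
    ∑' j, s.indicator (scaleFactor α) j ≤ geomConst α * scaleFactor α J := by
  have hinj : Function.Injective fun i : ℕ => J - (i : ℤ) := fun a b h => by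
    simpa using h
  calc ∑' j, s.indicator (scaleFactor α) j
      = ∑' i : ℕ, s.indicator (scaleFactor α) (J - i) := by
        refine (hinj.tsum_eq ?_).symm
        intro j hj
        have : j ∈ s := Set.mem_of_indicator_ne_zero hj
        exact ⟨(J - j).toNat, by have := hs j this; dsimp only; omega⟩
    _ ≤ ∑' i : ℕ, scaleFactor α J * ENNReal.ofReal (2 ^ (-α)) ^ i :=
        ENNReal.tsum_le_tsum fun i => by
          rw [← scaleFactor_sub]; exact Set.indicator_le_self _ _ _
    _ = geomConst α * scaleFactor α J := by
        rw [ENNReal.tsum_mul_left, ENNReal.tsum_geometric, mul_comm]; rfl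

open Classical in
-- Each term is charged to the level k with b^k < a_j ≤ b^(k+1). At level k all admissible
-- generations lie below a largest one J, whose cube is maximal, and the geometric series in ℓ^α
-- collapses onto it.
theorem tsum_scaleFactor_mul_avgProd_le {α : ℝ} (hn : 0 < n) (hm : 0 < m)
    {F : Fin m → EuclideanSpace ℝ (Fin n) → ℝ≥0∞} (hF : ∀ i, ∫⁻ x, F i x ≠ ∞) {b : ℝ≥0∞}
    (hb : 1 < b) (hbtop : b ≠ ∞) (x : EuclideanSpace ℝ (Fin n)) :
    ∑' j, scaleFactor α j * avgProd F j (dyadicIndex j x) ≤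
      b * geomConst α * ∑' k : ℤ, ∑' j, if IsMaximalCube F (b ^ k) j (dyadicIndex j x) then
        b ^ k * scaleFactor α j else 0 := by
  set a : ℤ → ℝ≥0∞ := fun j => avgProd F j (dyadicIndex j x) with ha
  have hb0 : b ≠ 0 := (zero_lt_one.trans hb).ne'
  have h₁ : ∀ j, scaleFactor α j * a j ≤
      ∑' k : ℤ, b * b ^ k * {j | b ^ k < a j}.indicator (scaleFactor α) j := by
    intro j
    rcases eq_or_ne (a j) 0 with h0 | h0
    · simp [h0]
    obtain ⟨k, hk₁, hk₂⟩ := ENNReal.exists_mem_Ioc_zpow h0 (avgProd_ne_top hF _ _) hb hbtop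
    refine le_trans ?_ (ENNReal.le_tsum k)
    rw [Set.indicator_of_mem (by exact hk₁), mul_comm]
    gcongr
    rwa [ENNReal.zpow_add hb0 hbtop, zpow_one, mul_comm] at hk₂
  refine (ENNReal.tsum_le_tsum h₁).trans ?_
  rw [ENNReal.tsum_comm, ← ENNReal.tsum_mul_left]
  refine ENNReal.tsum_le_tsum fun k => ?_
  rw [ENNReal.tsum_mul_left]
  by_cases hne : ∃ j, b ^ k < a j
  · obtain ⟨J₀, hJ₀⟩ := exists_avgProd_le hn hm hF (ENNReal.zpow_pos hb0 hbtop k).ne'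
    obtain ⟨J, hJ, hJmax⟩ := Int.exists_greatest_of_bdd (P := fun j => b ^ k < a j)
      ⟨J₀, fun j hj => by
        by_contra hlt
        exact (hJ₀ j (by omega) _).not_gt hj⟩ hne
    have hmax : IsMaximalCube F (b ^ k) J (dyadicIndex J x) := by
      refine ⟨hJ, fun y hy i hi => ?_⟩
      rw [dyadicIndex_eq_of_le hi.le hy]
      by_contra hlt
      exact absurd (hJmax i (not_le.1 hlt)) (not_le.2 hi)
    calc b * b ^ k * ∑' j, {j | b ^ k < a j}.indicator (scaleFactor α) j
        ≤ b * b ^ k * (geomConst α * scaleFactor α J) := by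
          gcongr
          exact tsum_scaleFactor_le α _ J fun j hj => hJmax j hj
      _ = b * geomConst α * (b ^ k * scaleFactor α J) := by ring
      _ ≤ _ := by
          gcongr
          refine le_trans ?_ (ENNReal.le_tsum J)
          rw [if_pos hmax]
  · have : {j | b ^ k < a j} = ∅ := by
      ext j; simpa using not_exists.1 hne j
    simp [this]

/-- The union of the maximal cubes at level `(2 ^ n * θ) ^ m * t` takes up a small portion of every
maximal cube at level `t`. -/
theorem volume_inter_superLevel_le {F : Fin m → EuclideanSpace ℝ (Fin n) → ℝ≥0∞}
    (hF : ∀ i, ∫⁻ x, F i x ≠ ∞) {t θ : ℝ≥0∞} (hθ : 1 ≤ θ) {j : ℤ} {z : Fin n → ℤ}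
    (hP : IsMaximalCube F t j z) :
    θ * volume (dyadicCube j z ∩ superLevel F ((2 ^ n * θ) ^ m * t)) ≤
      m * 5 ^ n * volume (tripleDyadic j z) := by
  set A : Fin m → ℤ → (Fin n → ℤ) → ℝ≥0∞ := fun i k y =>
    (volume (tripleDyadic k y))⁻¹ * ∫⁻ y in tripleDyadic k y, F i y with hA
  have hAvol : ∀ i k y, A i k y * volume (tripleDyadic k y) = ∫⁻ y in tripleDyadic k y, F i y := by
    intro i k y
    rw [hA, mul_comm, ← mul_assoc, ENNReal.mul_inv_cancel (volume_tripleDyadic_ne_zero _ _)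
      (volume_tripleDyadic_ne_top _ _), one_mul]
  have hA0 : ∀ i, A i j z ≠ 0 := fun i h =>
    (hP.1.trans_le (Finset.prod_eq_zero (Finset.mem_univ i) h).le).not_ge zero_le
  have hAtop : ∀ i, A i j z ≠ ∞ := fun i => ENNReal.mul_ne_top
    (ENNReal.inv_ne_top.2 (volume_tripleDyadic_ne_zero j z))
    (ne_top_of_le_ne_top (hF i) (setLIntegral_le_lintegral _ _))
  set T : Fin m → Set (ℤ × (Fin n → ℤ)) := fun i => {p | p.1 ≤ j ∧
    tripleDyadic p.1 p.2 ⊆ tripleDyadic j z ∧ θ * A i j z < A i p.1 p.2} with hT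
  -- The dyadic parent fails the level by maximality, and its tripled cube contains this one with
  -- 2^n times the volume, costing 2^n in each of the `m` averages.
  have hparent : avgProd F j z ≤ (2 ^ n) ^ m * t := by
    obtain ⟨x, rfl⟩ : ∃ x, dyadicIndex j x = z := by
      by_contra hne
      have : dyadicCube j z = ∅ := by
        exact Set.eq_empty_of_forall_notMem fun x h => hne ⟨x, h⟩
      have h0 := volume_dyadicCube j z
      rw [this, measure_empty] at h0
      exact pow_ne_zero n (by simp; positivity) h0.symm
    refine le_trans ?_ (mul_le_mul_right (hP.2 x rfl (j + 1) (by omega)) ((2 ^ n) ^ m))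
    unfold avgProd
    have hc : ((2 : ℝ≥0∞) ^ n) ^ m = ∏ _i : Fin m, 2 ^ n := by simp
    rw [hc, ← Finset.prod_mul_distrib]
    refine Finset.prod_le_prod' fun i _ => ?_
    rw [volume_tripleDyadic_succ j (dyadicIndex j x), ← mul_assoc,
      ENNReal.mul_inv (Or.inl (by simp)) (Or.inl (by finiteness)), ← mul_assoc,
      ENNReal.mul_inv_cancel (by simp) (by finiteness), one_mul]
    gcongr
    exact tripleDyadic_subset_of_le (by omega) x
  have hsub : dyadicCube j z ∩ superLevel F ((2 ^ n * θ) ^ m * t) ⊆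
      ⋃ i, ⋃ p ∈ T i, tripleDyadic p.1 p.2 := by
    rintro x ⟨rfl, k, hk⟩
    have hkj : k ≤ j := by
      by_contra! hlt
      refine (hP.2 x rfl k hlt).not_gt (lt_of_le_of_lt ?_ hk)
      refine le_mul_of_one_le_left' (one_le_pow₀ (one_le_mul ?_ hθ))
      exact one_le_pow₀ (by norm_num)
    -- A strict inequality of products forces one factor to grow by more than θ, reducing the
    -- multilinear statement to `m` linear weak-type bounds.
    have hlt : ∏ i, (θ * A i j (dyadicIndex j x)) < ∏ i, A i k (dyadicIndex k x) := by
      refine lt_of_le_of_lt ?_ hk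
      rw [Finset.prod_mul_distrib, Finset.prod_const, Finset.card_univ, Fintype.card_fin, mul_pow,
        mul_comm ((2 ^ n) ^ m), mul_assoc]
      gcongr
      exact hparent
    obtain ⟨i, hi⟩ : ∃ i, θ * A i j (dyadicIndex j x) < A i k (dyadicIndex k x) := by
      by_contra! hle
      exact (Finset.prod_le_prod' fun i _ => hle i).not_gt hlt
    exact Set.mem_iUnion.2 ⟨i, Set.mem_biUnion (x := (k, dyadicIndex k x))
      ⟨hkj, tripleDyadic_subset_of_le hkj x, hi⟩
      (closedDyadic_subset_tripleDyadic _ _ (dyadicCube_subset_closedDyadic _ _ rfl))⟩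
  have hweak : ∀ i, θ * volume (⋃ p ∈ T i, tripleDyadic p.1 p.2) ≤
      5 ^ n * volume (tripleDyadic j z) := by
    intro i
    -- Cutting `F i` off to the tripled cube leaves the averages over its subcubes unchanged and
    -- makes the total mass `A i j z` times its volume, so `A i j z` cancels.
    have h := volume_iUnion_cube_le (T i) (Set.to_countable _)
      (fun p => dyadicCenter p.1 p.2) (fun p => 3 * 2 ^ p.1) (fun p _ => by positivity)
      (3 * 2 ^ j) (fun p hp => by
        have : (2 : ℝ) ^ p.1 ≤ 2 ^ j := zpow_le_zpow_right₀ (by norm_num) hp.1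
        linarith) ((tripleDyadic j z).indicator (F i)) (θ * A i j z) (fun p hp => by
        rw [setLIntegral_indicator (measurableSet_tripleDyadic _ _),
          Set.inter_eq_right.2 (by exact hp.2.1)]
        refine le_trans ?_ (hAvol i p.1 p.2).le
        exact mul_le_mul_left hp.2.2.le _)
    rw [lintegral_indicator (measurableSet_tripleDyadic _ _), ← hAvol,
      mul_comm θ, mul_assoc, mul_left_comm (5 ^ n)] at h
    exact (ENNReal.mul_le_mul_iff_right (hA0 i) (hAtop i)).1 h
  calc θ * volume (dyadicCube j z ∩ superLevel F ((2 ^ n * θ) ^ m * t))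
      ≤ θ * ∑ i, volume (⋃ p ∈ T i, tripleDyadic p.1 p.2) := by
        gcongr
        exact (measure_mono hsub).trans (measure_iUnion_fintype_le _ _)
    _ ≤ ∑ _i : Fin m, 5 ^ n * volume (tripleDyadic j z) := by
        rw [Finset.mul_sum]; exact Finset.sum_le_sum fun i _ => hweak i
    _ = m * 5 ^ n * volume (tripleDyadic j z) := by simp [mul_assoc]

end Discrete

/-! ### Domination of the dyadic sum under RH_∞. -/

section Domination

variable {n m : ℕ}

/-- The average of `U` over the closure of a dyadic cube. -/
noncomputable def dyadicAvg (U : EuclideanSpace ℝ (Fin n) → ℝ≥0∞) (j : ℤ) (z : Fin n → ℤ) :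
    ℝ≥0∞ :=
  (volume (closedDyadic j z))⁻¹ * ∫⁻ y in closedDyadic j z, U y

/-- The `RH_∞` condition with constant `K` on closed dyadic cubes. -/
def DyadicRHInfty (K : ℝ≥0∞) (V : EuclideanSpace ℝ (Fin n) → ℝ≥0∞) : Prop :=
  ∀ j z, essSup V (volume.restrict (closedDyadic j z)) ≤ K * dyadicAvg V j z

theorem volume_closedDyadic_ne_zero (j : ℤ) (z : Fin n → ℤ) : volume (closedDyadic j z) ≠ 0 :=
  volume_cube_ne_zero _ (by positivity)

theorem volume_closedDyadic_ne_top (j : ℤ) (z : Fin n → ℤ) : volume (closedDyadic j z) ≠ ∞ :=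
  volume_cube_ne_top _ _

theorem measurableSet_closedDyadic (j : ℤ) (z : Fin n → ℤ) : MeasurableSet (closedDyadic j z) :=
  measurableSet_cube _ _

/-- Replace V by its essential supremum, at most K times its average, then move the normalization
1/|Q| from V to U. -/
theorem setLIntegral_mul_le_of_dyadicRHInfty {K : ℝ≥0∞} {U V : EuclideanSpace ℝ (Fin n) → ℝ≥0∞}
    (hU : AEMeasurable U volume) (hV : DyadicRHInfty K V) (j : ℤ) (z : Fin n → ℤ) :
    ∫⁻ x in dyadicCube j z, U x * V x ≤
      K * dyadicAvg U j z * ∫⁻ x in closedDyadic j z, V x := by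
  calc ∫⁻ x in dyadicCube j z, U x * V x
      ≤ ∫⁻ x in closedDyadic j z, U x * V x :=
        lintegral_mono_set (dyadicCube_subset_closedDyadic j z)
    _ ≤ ∫⁻ x in closedDyadic j z, U x * (K * dyadicAvg V j z) := by
        refine lintegral_mono_ae ?_
        filter_upwards [ae_le_essSup (f := V) (μ := volume.restrict (closedDyadic j z))] with x hx
        gcongr
        exact hx.trans (hV j z)
    _ = K * dyadicAvg U j z * ∫⁻ x in closedDyadic j z, V x := by
        rw [lintegral_mul_const'' _ hU.restrict, dyadicAvg, dyadicAvg]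
        ring

/-- An A_∞-type consequence of RH_∞: a subset filling at most 1/(2K) of a cube has at most half of
its V-mass. -/
theorem setLIntegral_closedDyadic_le {K : ℝ≥0∞}
    {V : EuclideanSpace ℝ (Fin n) → ℝ≥0∞} (hV : DyadicRHInfty K V) {j : ℤ} {z : Fin n → ℤ}
    (hfin : ∫⁻ x in closedDyadic j z, V x ≠ ∞) {S : Set (EuclideanSpace ℝ (Fin n))}
    (hS : MeasurableSet S)
    (hvol : 2 * K * volume (dyadicCube j z ∩ S) ≤ volume (closedDyadic j z)) :
    ∫⁻ x in closedDyadic j z, V x ≤ 2 * ∫⁻ x in dyadicCube j z \ S, V x := by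
  set I := ∫⁻ x in closedDyadic j z, V x with hI
  have hD := dyadicCube_subset_closedDyadic j z
  have hE : MeasurableSet (dyadicCube j z \ S) := (measurableSet_dyadicCube j z).diff hS
  have hsplit : I = (∫⁻ x in dyadicCube j z \ S, V x) +
      ∫⁻ x in closedDyadic j z \ (dyadicCube j z \ S), V x := by
    rw [hI, ← lintegral_inter_add_sdiff V (closedDyadic j z) hE,
      Set.inter_eq_right.2 (Set.sdiff_subset.trans hD)]
  have hvol' : volume (closedDyadic j z \ (dyadicCube j z \ S)) ≤ volume (dyadicCube j z ∩ S) := by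
    refine (measure_mono (t := (closedDyadic j z \ dyadicCube j z) ∪ (dyadicCube j z ∩ S))
      ?_).trans ((measure_union_le _ _).trans (by rw [volume_closedDyadic_diff, zero_add]))
    rintro x ⟨hx, hx'⟩
    by_cases hxD : x ∈ dyadicCube j z
    · exact Or.inr ⟨hxD, by by_contra h; exact hx' ⟨hxD, h⟩⟩
    · exact Or.inl ⟨hx, hxD⟩
  have hrest : 2 * ∫⁻ x in closedDyadic j z \ (dyadicCube j z \ S), V x ≤ I := by
    calc 2 * ∫⁻ x in closedDyadic j z \ (dyadicCube j z \ S), V x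
        ≤ 2 * ∫⁻ _ in closedDyadic j z \ (dyadicCube j z \ S), K * dyadicAvg V j z := by
          gcongr 2 * ?_
          refine lintegral_mono_ae ?_
          filter_upwards [ae_restrict_of_ae_restrict_of_subset
            (Set.sdiff_subset (t := dyadicCube j z \ S))
            (ae_le_essSup (f := V) (μ := volume.restrict (closedDyadic j z)))] with x hx
          exact hx.trans (hV j z)
      _ ≤ 2 * (K * dyadicAvg V j z * volume (dyadicCube j z ∩ S)) := by
          rw [setLIntegral_const]; gcongr
      _ = 2 * K * volume (dyadicCube j z ∩ S) * ((volume (closedDyadic j z))⁻¹ * I) := by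
          rw [dyadicAvg]; ring
      _ ≤ volume (closedDyadic j z) * ((volume (closedDyadic j z))⁻¹ * I) := by gcongr
      _ = I := by
          rw [← mul_assoc, ENNReal.mul_inv_cancel (volume_closedDyadic_ne_zero _ _)
            (volume_closedDyadic_ne_top _ _), one_mul]
  -- One copy of `I` is cancelled at the end, which is where its finiteness enters.
  have h2 : I + I ≤ 2 * (∫⁻ x in dyadicCube j z \ S, V x) + I := by
    calc I + I = 2 * I := (two_mul I).symm
      _ = 2 * (∫⁻ x in dyadicCube j z \ S, V x) +
          2 * ∫⁻ x in closedDyadic j z \ (dyadicCube j z \ S), V x := by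
          rw [← mul_add, ← hsplit]
      _ ≤ _ := by gcongr
  exact (ENNReal.add_le_add_iff_right hfin).1 h2

/-- The part of a maximal cube at level `b ^ k` that lies outside the next level set. -/
def exceptionalPart (F : Fin m → EuclideanSpace ℝ (Fin n) → ℝ≥0∞) (b : ℝ≥0∞) (k j : ℤ)
    (z : Fin n → ℤ) : Set (EuclideanSpace ℝ (Fin n)) :=
  {x | x ∈ dyadicCube j z \ superLevel F (b ^ (k + 1)) ∧ IsMaximalCube F (b ^ k) j z}

/-- The parts are disjoint. A point in a maximal cube of a higher level lies in the level set
removed from the lower one, and at a fixed level two maximal cubes sharing a point coincide. -/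
theorem tsum_setLIntegral_exceptionalPart_le (F : Fin m → EuclideanSpace ℝ (Fin n) → ℝ≥0∞)
    {b : ℝ≥0∞} (hb : 1 ≤ b) (g : EuclideanSpace ℝ (Fin n) → ℝ≥0∞) :
    ∑' k : ℤ, ∑' j : ℤ, ∑' z, ∫⁻ x in exceptionalPart F b k j z, g x ≤ ∫⁻ x, g x := by
  let E : ℤ × ℤ × (Fin n → ℤ) → Set (EuclideanSpace ℝ (Fin n)) :=
    fun p => exceptionalPart F b p.1 p.2.1 p.2.2
  have hmeas : ∀ p, MeasurableSet (E p) := by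
    intro p
    by_cases hp : IsMaximalCube F (b ^ p.1) p.2.1 p.2.2
    · have : E p = dyadicCube p.2.1 p.2.2 \ superLevel F (b ^ (p.1 + 1)) := by
        ext x; exact and_iff_left hp
      rw [this]
      exact (measurableSet_dyadicCube _ _).diff (measurableSet_superLevel _ _)
    · have : E p = ∅ := Set.eq_empty_of_forall_notMem fun x hx => hp hx.2
      rw [this]; exact MeasurableSet.empty
  have hlevel : ∀ k k' : ℤ, k < k' → ∀ j j' z z' x, x ∈ exceptionalPart F b k j z →
      x ∉ exceptionalPart F b k' j' z' := by
    rintro k k' hk j j' z z' x hx ⟨⟨rfl, -⟩, hx'⟩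
    exact hx.1.2 ⟨j', (ENNReal.zpow_le_of_le hb (by omega)).trans_lt hx'.1⟩
  have hgen : ∀ k j j' : ℤ, j < j' → ∀ z z' x, x ∈ exceptionalPart F b k j z →
      x ∉ exceptionalPart F b k j' z' := by
    rintro k j j' hj z z' x hx ⟨⟨rfl, -⟩, hx'⟩
    exact (hx.2.2 x hx.1.1 j' hj).not_gt hx'.1
  have hdisj : Pairwise (Function.onFun Disjoint E) := by
    rintro ⟨k, j, z⟩ ⟨k', j', z'⟩ hne
    rw [Function.onFun, Set.disjoint_left]
    intro x hx hx'
    rcases lt_trichotomy k k' with hk | rfl | hk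
    · exact hlevel _ _ hk _ _ _ _ x hx hx'
    · rcases lt_trichotomy j j' with hj | rfl | hj
      · exact hgen _ _ _ hj _ _ x hx hx'
      · exact hne (by rw [show z = z' from hx.1.1.symm.trans hx'.1.1])
      · exact hgen _ _ _ hj _ _ x hx' hx
    · exact hlevel _ _ hk _ _ _ _ x hx' hx
  calc ∑' k : ℤ, ∑' j : ℤ, ∑' z, ∫⁻ x in exceptionalPart F b k j z, g x
      = ∑' p, ∫⁻ x in E p, g x := by
        rw [ENNReal.tsum_prod']
        refine tsum_congr fun k => ?_
        rw [ENNReal.tsum_prod']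
    _ = ∫⁻ x in ⋃ p, E p, g x := (lintegral_iUnion hmeas hdisj g).symm
    _ ≤ ∫⁻ x, g x := setLIntegral_le_lintegral _ _

/-- The threshold in the weak type estimate that makes level sets sufficiently sparse. -/
noncomputable def sparseConst (n m : ℕ) (K : ℝ≥0∞) : ℝ≥0∞ := 2 * K * ((m + 1) * 15 ^ n)

/-- The ratio between consecutive levels. -/
noncomputable def levelRatio (n m : ℕ) (K : ℝ≥0∞) : ℝ≥0∞ := (2 ^ n * sparseConst n m K) ^ m

theorem one_lt_sparseConst (n m : ℕ) {K : ℝ≥0∞} (hK : 1 ≤ K) : 1 < sparseConst n m K := by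
  unfold sparseConst
  calc (1 : ℝ≥0∞) < 2 * 1 * ((0 + 1) * 1) := by norm_num
    _ ≤ _ := by
      gcongr
      · exact zero_le
      · exact one_le_pow₀ (by norm_num)

theorem one_lt_levelRatio {n m : ℕ} (hm : 0 < m) {K : ℝ≥0∞} (hK : 1 ≤ K) :
    1 < levelRatio n m K := by
  unfold levelRatio
  refine one_lt_pow₀ ?_ hm.ne'
  exact (one_lt_sparseConst n m hK).trans_le (le_mul_of_one_le_left' (one_le_pow₀ (by norm_num)))

theorem levelRatio_ne_top (n m : ℕ) {K : ℝ≥0∞} (hK : K ≠ ∞) : levelRatio n m K ≠ ∞ := by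
  unfold levelRatio sparseConst
  finiteness

/-- The estimate for one cube: RH_∞ separates U from V, sparseness moves the V-mass to the
exceptional part, and there the constant `c` is dominated by N. -/
theorem mul_setLIntegral_le_of_isMaximalCube {α : ℝ} (hm : 0 < m) {K : ℝ≥0∞} (hK1 : 1 ≤ K) (hK : K ≠ ∞)
    {F : Fin m → EuclideanSpace ℝ (Fin n) → ℝ≥0∞} (hF : ∀ i, ∫⁻ x, F i x ≠ ∞)
    {U V N : EuclideanSpace ℝ (Fin n) → ℝ≥0∞} (hU : AEMeasurable U volume)
    (hV : DyadicRHInfty K V)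
    (hN : ∀ j z, ∀ x ∈ closedDyadic j z, scaleFactor α j * avgProd F j z * dyadicAvg U j z ≤ N x)
    (hfin : ∫⁻ x, N x * V x ≠ ∞) {k j : ℤ} {z : Fin n → ℤ}
    (hP : IsMaximalCube F (levelRatio n m K ^ k) j z) :
    levelRatio n m K ^ k * scaleFactor α j * ∫⁻ x in dyadicCube j z, U x * V x ≤
      2 * K * ∫⁻ x in exceptionalPart F (levelRatio n m K) k j z, N x * V x := by
  set b := levelRatio n m K with hb
  set I := ∫⁻ x in closedDyadic j z, V x with hI
  set c := b ^ k * scaleFactor α j * dyadicAvg U j z with hc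
  have hcN : ∀ x ∈ closedDyadic j z, c ≤ N x := fun x hx => by
    refine le_trans ?_ (hN j z x hx)
    rw [hc, mul_comm (b ^ k)]
    gcongr
    exact hP.1.le
  have hle : ∀ S ⊆ closedDyadic j z, MeasurableSet S →
      c * ∫⁻ x in S, V x ≤ ∫⁻ x in S, N x * V x := by
    intro S hS hSm
    -- Only the inequality for pulling out a constant is needed, so no measurability of N or of the
    -- product is involved.
    refine (lintegral_const_mul_le _ _).trans (setLIntegral_mono' hSm fun x hx => ?_)
    gcongr
    exact hcN x (hS hx)
  have hmain : b ^ k * scaleFactor α j * ∫⁻ x in dyadicCube j z, U x * V x ≤ K * (c * I) := by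
    calc b ^ k * scaleFactor α j * ∫⁻ x in dyadicCube j z, U x * V x
        ≤ b ^ k * scaleFactor α j * (K * dyadicAvg U j z * I) := by
          gcongr
          exact setLIntegral_mul_le_of_dyadicRHInfty hU hV j z
      _ = K * (c * I) := by rw [hc]; ring
  refine hmain.trans ?_
  rcases eq_or_ne c 0 with h0 | h0
  · simp [h0]
  have hIfin : I ≠ ∞ := by
    intro htop
    have h := (hle _ subset_rfl (measurableSet_closedDyadic j z)).trans
      (setLIntegral_le_lintegral _ _)
    rw [← hI, htop, ENNReal.mul_top h0] at h
    exact hfin (top_le_iff.1 h)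
  have hpart : exceptionalPart F b k j z = dyadicCube j z \ superLevel F (b ^ (k + 1)) := by
    ext x; exact and_iff_left hP
  have hb0 : b ≠ 0 := (zero_lt_one.trans (one_lt_levelRatio hm hK1)).ne'
  have hvol : 2 * K * volume (dyadicCube j z ∩ superLevel F (b ^ (k + 1))) ≤
      volume (closedDyadic j z) := by
    have h := volume_inter_superLevel_le hF (one_lt_sparseConst n m hK1).le hP
    rw [ENNReal.zpow_add hb0 (levelRatio_ne_top n m hK), zpow_one, mul_comm (b ^ k)]
    rw [volume_tripleDyadic_eq_mul] at h
    -- The 15^n is 5^n from Vitali times 3^n from tripling; `m + 1` in place of `m` makes the factor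
    -- visibly nonzero.
    have hd0 : ((m : ℝ≥0∞) + 1) * 15 ^ n ≠ 0 := by simp
    have hdt : ((m : ℝ≥0∞) + 1) * 15 ^ n ≠ ∞ := by finiteness
    refine (ENNReal.mul_le_mul_iff_right hd0 hdt).1 ?_
    calc ((m : ℝ≥0∞) + 1) * 15 ^ n * (2 * K * volume (dyadicCube j z ∩ superLevel F (b * b ^ k)))
        = sparseConst n m K * volume (dyadicCube j z ∩ superLevel F (b * b ^ k)) := by
          rw [sparseConst]; ring
      _ ≤ m * 5 ^ n * (3 ^ n * volume (closedDyadic j z)) := h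
      _ = m * 15 ^ n * volume (closedDyadic j z) := by
          rw [show (15 : ℝ≥0∞) = 5 * 3 by norm_num, mul_pow]; ring
      _ ≤ (m + 1) * 15 ^ n * volume (closedDyadic j z) := by
          gcongr; exact le_self_add
  have hS := measurableSet_superLevel F (b ^ (k + 1))
  calc K * (c * I)
      ≤ K * (c * (2 * ∫⁻ x in dyadicCube j z \ superLevel F (b ^ (k + 1)), V x)) := by
        gcongr
        exact setLIntegral_closedDyadic_le hV hIfin hS hvol
    _ = 2 * K * (c * ∫⁻ x in dyadicCube j z \ superLevel F (b ^ (k + 1)), V x) := by ring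
    _ ≤ 2 * K * ∫⁻ x in exceptionalPart F b k j z, N x * V x := by
        rw [hpart]
        gcongr
        exact hle _ (Set.sdiff_subset.trans (dyadicCube_subset_closedDyadic j z))
          ((measurableSet_dyadicCube j z).diff hS)

/-- The constant in the dyadic domination estimate. -/
noncomputable def dominationConst (n m : ℕ) (α : ℝ) (K : ℝ≥0∞) : ℝ≥0∞ :=
  levelRatio n m K * geomConst α * (2 * K)

theorem tsum_dyadic_le_of_integrable {α : ℝ} (hn : 0 < n) (hm : 0 < m) {K : ℝ≥0∞} (hK1 : 1 ≤ K)
    (hK : K ≠ ∞) {F : Fin m → EuclideanSpace ℝ (Fin n) → ℝ≥0∞} (hF : ∀ i, ∫⁻ x, F i x ≠ ∞)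
    {U V N : EuclideanSpace ℝ (Fin n) → ℝ≥0∞} (hU : AEMeasurable U volume)
    (hVm : AEMeasurable V volume) (hV : DyadicRHInfty K V)
    (hN : ∀ j z, ∀ x ∈ closedDyadic j z, scaleFactor α j * avgProd F j z * dyadicAvg U j z ≤ N x)
    (hfin : ∫⁻ x, N x * V x ≠ ∞) :
    ∑' j, ∑' z, scaleFactor α j * avgProd F j z * ∫⁻ x in dyadicCube j z, U x * V x ≤
      dominationConst n m α K * ∫⁻ x, N x * V x := by
  classical
  set b := levelRatio n m K with hb
  have hUV : AEMeasurable (fun x => U x * V x) volume := hU.mul hVm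
  rw [← lintegral_tsum_dyadicIndex (fun j z => scaleFactor α j * avgProd F j z) hUV]
  have hb1 : 1 < b := one_lt_levelRatio hm hK1
  have hbtop : b ≠ ∞ := levelRatio_ne_top n m hK
  let d : ℤ → ℤ → (Fin n → ℤ) → ℝ≥0∞ := fun k j z =>
    if IsMaximalCube F (b ^ k) j z then b ^ k * scaleFactor α j else 0
  have hdm : ∀ k, AEMeasurable (fun x : EuclideanSpace ℝ (Fin n) =>
      (∑' j, d k j (dyadicIndex j x)) * (U x * V x)) volume := fun k =>
    (Measurable.tsum fun j => (measurable_of_countable (d k j)).comp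
      (measurable_dyadicIndex j)).aemeasurable.mul hUV
  calc ∫⁻ x, (∑' j, scaleFactor α j * avgProd F j (dyadicIndex j x)) * (U x * V x)
      ≤ ∫⁻ x, b * geomConst α *
          ∑' k, (∑' j, d k j (dyadicIndex j x)) * (U x * V x) := by
        refine lintegral_mono fun x => ?_
        rw [ENNReal.tsum_mul_right, ← mul_assoc (b * geomConst α)]
        gcongr ?_ * _
        exact tsum_scaleFactor_mul_avgProd_le hn hm hF hb1 hbtop x
    _ = b * geomConst α * ∑' k, ∑' j, ∑' z, d k j z * ∫⁻ x in dyadicCube j z, U x * V x := by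
        rw [lintegral_const_mul'' _ (AEMeasurable.tsum hdm), lintegral_tsum hdm]
        congr 1
        exact tsum_congr fun k => lintegral_tsum_dyadicIndex (d k) hUV
    _ ≤ b * geomConst α * ∑' k, ∑' j, ∑' z,
          2 * K * ∫⁻ x in exceptionalPart F b k j z, N x * V x := by
        refine mul_le_mul_right (ENNReal.tsum_le_tsum fun k => ENNReal.tsum_le_tsum fun j =>
          ENNReal.tsum_le_tsum fun z => ?_) _
        by_cases hP : IsMaximalCube F (b ^ k) j z
        · simp only [d, if_pos hP]
          exact mul_setLIntegral_le_of_isMaximalCube hm hK1 hK hF hU hV hN hfin hP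
        · simp [d, if_neg hP]
    _ = dominationConst n m α K *
          ∑' k, ∑' j, ∑' z, ∫⁻ x in exceptionalPart F b k j z, N x * V x := by
        simp only [ENNReal.tsum_mul_left]
        rw [dominationConst]; ring
    _ ≤ dominationConst n m α K * ∫⁻ x, N x * V x := by
        gcongr
        exact tsum_setLIntegral_exceptionalPart_le F hb1.le _

/-- Removes integrability of F: a finite partial sum sees F only on finitely many tripled cubes, and
F can be truncated to their union. -/
theorem tsum_dyadic_le {α : ℝ} (hn : 0 < n) (hm : 0 < m) {K : ℝ≥0∞} (hK1 : 1 ≤ K)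
    (hK : K ≠ ∞) {F : Fin m → EuclideanSpace ℝ (Fin n) → ℝ≥0∞}
    {U V N : EuclideanSpace ℝ (Fin n) → ℝ≥0∞} (hU : AEMeasurable U volume)
    (hVm : AEMeasurable V volume) (hV : DyadicRHInfty K V)
    (hN : ∀ j z, ∀ x ∈ closedDyadic j z, scaleFactor α j * avgProd F j z * dyadicAvg U j z ≤ N x)
    (hfin : ∫⁻ x, N x * V x ≠ ∞) :
    ∑' j, ∑' z, scaleFactor α j * avgProd F j z * ∫⁻ x in dyadicCube j z, U x * V x ≤
      dominationConst n m α K * ∫⁻ x, N x * V x := by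
  classical
  let τ : (Fin m → EuclideanSpace ℝ (Fin n) → ℝ≥0∞) → ℤ × (Fin n → ℤ) → ℝ≥0∞ := fun G p =>
    scaleFactor α p.1 * avgProd G p.1 p.2 * ∫⁻ x in dyadicCube p.1 p.2, U x * V x
  have hτ : ∀ G, ∑' j, ∑' z, scaleFactor α j * avgProd G j z *
      ∫⁻ x in dyadicCube j z, U x * V x = ∑' p, τ G p := fun G => by rw [ENNReal.tsum_prod']
  rw [hτ, ENNReal.tsum_eq_iSup_sum]
  refine iSup_le fun s => ?_
  rw [← Finset.sum_filter_ne_zero]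
  set s' := s.filter fun p => τ F p ≠ 0 with hs'
  -- If a nonzero term had an infinite average, N would be infinite on a closed cube of positive
  -- V-mass, contradicting `hfin`.
  have hint : ∀ p ∈ s', ∀ i, ∫⁻ x in tripleDyadic p.1 p.2, F i x ≠ ∞ := by
    intro p hp i hi
    have hp0 : τ F p ≠ 0 := (Finset.mem_filter.1 hp).2
    have havg0 : avgProd F p.1 p.2 ≠ 0 := fun h => hp0 (by simp [τ, h])
    have hUV0 : ∫⁻ x in dyadicCube p.1 p.2, U x * V x ≠ 0 := fun h => hp0 (by simp [τ, h])
    have hscale : scaleFactor α p.1 ≠ 0 := fun h => hp0 (by simp [τ, h])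
    have hprod : K * dyadicAvg U p.1 p.2 * ∫⁻ x in closedDyadic p.1 p.2, V x ≠ 0 := fun h =>
      hUV0 (le_zero_iff.1 ((setLIntegral_mul_le_of_dyadicRHInfty hU hV p.1 p.2).trans h.le))
    have havgtop : avgProd F p.1 p.2 = ∞ := by
      unfold avgProd at havg0 ⊢
      rw [← Finset.mul_prod_erase _ _ (Finset.mem_univ i)] at havg0 ⊢
      rw [hi, ENNReal.mul_top (ENNReal.inv_ne_zero.2 (volume_tripleDyadic_ne_top _ _))]
      exact ENNReal.top_mul (right_ne_zero_of_mul havg0)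
    have hNtop : ∀ x ∈ closedDyadic p.1 p.2, ∞ ≤ N x := fun x hx => by
      refine le_trans ?_ (hN p.1 p.2 x hx)
      rw [havgtop, ENNReal.mul_top hscale,
        ENNReal.top_mul (right_ne_zero_of_mul (left_ne_zero_of_mul hprod))]
    refine hfin (top_le_iff.1 ?_)
    calc ∞ = ∞ * ∫⁻ x in closedDyadic p.1 p.2, V x :=
          (ENNReal.top_mul (right_ne_zero_of_mul hprod)).symm
      _ ≤ ∫⁻ x in closedDyadic p.1 p.2, ∞ * V x := lintegral_const_mul_le _ _
      _ ≤ ∫⁻ x in closedDyadic p.1 p.2, N x * V x :=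
          setLIntegral_mono' (measurableSet_closedDyadic _ _) fun x hx => by
            gcongr; exact hNtop x hx
      _ ≤ ∫⁻ x, N x * V x := setLIntegral_le_lintegral _ _
  set B : Set (EuclideanSpace ℝ (Fin n)) := ⋃ p ∈ s', tripleDyadic p.1 p.2 with hB
  have hBm : MeasurableSet B :=
    Finset.measurableSet_biUnion s' fun p _ => measurableSet_tripleDyadic _ _
  set G : Fin m → EuclideanSpace ℝ (Fin n) → ℝ≥0∞ := fun i => B.indicator (F i) with hG
  have hGF : ∀ i x, G i x ≤ F i x := fun i x => Set.indicator_le_self _ _ _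
  have hGint : ∀ i, ∫⁻ x, G i x ≠ ∞ := by
    intro i
    rw [hG, lintegral_indicator hBm]
    have hB' : B = ⋃ p : s', tripleDyadic p.1.1 p.1.2 :=
      Set.biUnion_eq_iUnion (s' : Set (ℤ × (Fin n → ℤ))) fun p _ => tripleDyadic p.1 p.2
    rw [hB']
    refine ne_top_of_le_ne_top ?_ (lintegral_iUnion_le _ _)
    rw [tsum_fintype]
    exact ENNReal.sum_ne_top.2 fun p _ => hint p p.2 i
  have heq : ∀ p ∈ s', τ F p = τ G p := by
    intro p hp
    have : avgProd F p.1 p.2 = avgProd G p.1 p.2 := by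
      refine Finset.prod_congr rfl fun i _ => ?_
      congr 1
      refine setLIntegral_congr_fun (measurableSet_tripleDyadic _ _) fun x hx => ?_
      exact (Set.indicator_of_mem (Set.mem_biUnion (Finset.mem_coe.2 hp) hx) _).symm
    simp only [τ, this]
  rw [Finset.sum_congr rfl heq]
  refine (ENNReal.sum_le_tsum s').trans ?_
  rw [← hτ]
  refine tsum_dyadic_le_of_integrable hn hm hK1 hK hGint hU hVm hV (fun j z x hx => ?_) hfin
  refine le_trans ?_ (hN j z x hx)
  gcongr
  unfold avgProd
  gcongr
  exact hGF _ _

end Domination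

/-! ### Return to the maximal functions, and absolute convergence. -/

section Final

variable {n m : ℕ}

theorem scaleFactor_eq_volume_rpow (hn : 0 < n) (α : ℝ) (j : ℤ) (z : Fin n → ℤ) :
    scaleFactor α j = volume (tripleDyadic j z) ^ (α / n) := by
  have h3 : (0 : ℝ) < 3 * 2 ^ j := by positivity
  rw [scaleFactor, volume_tripleDyadic, ← ENNReal.rpow_natCast, ← ENNReal.rpow_mul,
    mul_div_cancel₀ _ (by exact_mod_cast hn.ne'), ENNReal.ofReal_rpow_of_pos h3]

theorem scaleFactor_mul_avgProd_le_fracMaximal (hn : 0 < n) (α : ℝ)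
    (f : Fin m → EuclideanSpace ℝ (Fin n) → ℝ) {j : ℤ} {z : Fin n → ℤ}
    {x : EuclideanSpace ℝ (Fin n)} (hx : x ∈ closedDyadic j z) :
    scaleFactor α j * avgProd (fun i y => ‖f i y‖ₑ) j z ≤ fracMaximal α f x := by
  rw [scaleFactor_eq_volume_rpow hn α j z]
  exact le_iSup₂_of_le (dyadicCenter j z) (3 * 2 ^ j) <| le_iSup₂_of_le (by positivity)
    (closedDyadic_subset_tripleDyadic j z hx) le_rfl

theorem dyadicAvg_le_hlMaximal (g : EuclideanSpace ℝ (Fin n) → ℝ) {j : ℤ} {z : Fin n → ℤ}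
    {x : EuclideanSpace ℝ (Fin n)} (hx : x ∈ closedDyadic j z) :
    dyadicAvg (fun y => ‖g y‖ₑ) j z ≤ hlMaximal g x :=
  le_iSup₂_of_le (dyadicCenter j z) (2 ^ j) <| le_iSup₂_of_le (by positivity) hx le_rfl

theorem geomMean_nonneg {w : Fin m → EuclideanSpace ℝ (Fin n) → ℝ} (hw : ∀ i, IsWeight (w i))
    (x : EuclideanSpace ℝ (Fin n)) : 0 ≤ geomMean w x :=
  Finset.prod_nonneg fun i _ => Real.rpow_nonneg ((hw i).nonneg x) _

theorem aemeasurable_geomMean {w : Fin m → EuclideanSpace ℝ (Fin n) → ℝ}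
    (hw : ∀ i, IsWeight (w i)) : AEMeasurable (geomMean w) volume :=
  Finset.aemeasurable_fun_prod _ fun i _ => (hw i).aemeasurable.pow_const _

theorem aemeasurable_fracIntegrand (α : ℝ) {f : Fin m → EuclideanSpace ℝ (Fin n) → ℝ}
    (hf : ∀ i, AEMeasurable (f i) volume) (x : EuclideanSpace ℝ (Fin n)) :
    AEMeasurable (fracIntegrand α f x) volume := by
  unfold fracIntegrand
  refine (Finset.aemeasurable_fun_prod _ fun i _ =>
    (hf i).comp_quasiMeasurePreserving (Measure.quasiMeasurePreserving_eval _ i)).div ?_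
  exact Measurable.aemeasurable (by fun_prop)

theorem aemeasurable_uncurry_fracIntegrand (α : ℝ)
    {f : Fin m → EuclideanSpace ℝ (Fin n) → ℝ} (hf : ∀ i, AEMeasurable (f i) volume) :
    AEMeasurable (Function.uncurry (fracIntegrand α f)) (volume.prod volume) := by
  unfold fracIntegrand Function.uncurry
  refine (Finset.aemeasurable_fun_prod _ fun i _ => (hf i).comp_quasiMeasurePreserving
    ((Measure.quasiMeasurePreserving_eval _ i).comp Measure.quasiMeasurePreserving_snd)).div ?_
  fun_prop

theorem lintegral_fracIntegralAbs_mul_le {α : ℝ} (hn : 0 < n) (hm : 0 < m) (hαnm : α < n * m)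
    {K : ℝ≥0∞} (hK1 : 1 ≤ K) (hK : K ≠ ∞) {v : EuclideanSpace ℝ (Fin n) → ℝ}
    (hv : AEMeasurable v volume) (hRH : DyadicRHInfty K fun x => ENNReal.ofReal (v x))
    {u : EuclideanSpace ℝ (Fin n) → ℝ} (hu : AEMeasurable u volume) (hu0 : ∀ x, 0 ≤ u x)
    {f : Fin m → EuclideanSpace ℝ (Fin n) → ℝ} (hf : ∀ i, AEMeasurable (f i) volume)
    (hfin : ∫⁻ x, fracMaximal α f x * hlMaximal u x * ENNReal.ofReal (v x) ≠ ∞) :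
    ∫⁻ x, fracIntegralAbs α f x * ENNReal.ofReal (u x) * ENNReal.ofReal (v x) ≤
      ENNReal.ofReal (6 ^ ((m : ℝ) * n - α)) * dominationConst n m α K *
        ∫⁻ x, fracMaximal α f x * hlMaximal u x * ENNReal.ofReal (v x) := by
  have hUV : AEMeasurable (fun x => ‖u x‖ₑ * ENNReal.ofReal (v x)) volume :=
    hu.enorm.mul hv.ennreal_ofReal
  have key := tsum_dyadic_le (α := α) (F := fun i y => ‖f i y‖ₑ) (U := fun y => ‖u y‖ₑ)
    (N := fun x => fracMaximal α f x * hlMaximal u x) hn hm hK1 hK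
    hu.enorm hv.ennreal_ofReal hRH (fun j z x hx =>
      mul_le_mul' (scaleFactor_mul_avgProd_le_fracMaximal hn α f hx)
        (dyadicAvg_le_hlMaximal u hx)) hfin
  rw [← lintegral_tsum_dyadicIndex
    (fun j z => scaleFactor α j * avgProd (fun i y => ‖f i y‖ₑ) j z) hUV] at key
  rw [mul_assoc]
  refine le_trans ?_ (mul_le_mul_right key _)
  rw [← lintegral_const_mul' _ _ ENNReal.ofReal_ne_top]
  refine lintegral_mono fun x => ?_
  rw [mul_assoc, ← mul_assoc (ENNReal.ofReal _), ← Real.enorm_of_nonneg (hu0 x)]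
  gcongr
  exact fracIntegralAbs_le_tsum hαnm f hf x

theorem DyadicRHInfty.of_rhInfty {v : EuclideanSpace ℝ (Fin n) → ℝ} (h : RHInfty v) :
    ∃ K : ℝ≥0∞, 1 ≤ K ∧ K ≠ ∞ ∧ DyadicRHInfty K fun x => ENNReal.ofReal (v x) := by
  obtain ⟨K, -, hK⟩ := h
  refine ⟨max K 1, le_max_right _ _, by simp, fun j z => ?_⟩
  refine (hK (dyadicCenter j z) (2 ^ j) (by positivity)).trans ?_
  exact mul_le_mul_left (le_max_left _ _) _

theorem ae_integrable_fracIntegrand {α : ℝ} {f : Fin m → EuclideanSpace ℝ (Fin n) → ℝ}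
    (hf : ∀ i, AEMeasurable (f i) volume) {u v : EuclideanSpace ℝ (Fin n) → ℝ}
    (hu : AEMeasurable u volume) (hu0 : ∀ x, 0 ≤ u x) (hv : AEMeasurable v volume)
    (hv0 : ∀ x, 0 ≤ v x)
    (hfin : ∫⁻ x, fracIntegralAbs α f x * ENNReal.ofReal (u x) * ENNReal.ofReal (v x) ≠ ∞) :
    ∀ᵐ x, u x * v x ≠ 0 → Integrable (fracIntegrand α f x) := by
  have hI : AEMeasurable (fracIntegralAbs α f) volume :=
    (aemeasurable_uncurry_fracIntegrand α hf).enorm.lintegral_prod_right'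
  filter_upwards [ae_lt_top' ((hI.mul hu.ennreal_ofReal).mul hv.ennreal_ofReal) hfin] with x hx hne
  refine ⟨(aemeasurable_fracIntegrand α hf x).aestronglyMeasurable, ?_⟩
  have hu' : ENNReal.ofReal (u x) ≠ 0 := by
    simpa using (hu0 x).lt_of_ne' (left_ne_zero_of_mul hne)
  have hv' : ENNReal.ofReal (v x) ≠ 0 := by
    simpa using (hv0 x).lt_of_ne' (right_ne_zero_of_mul hne)
  by_contra htop
  have htop' : fracIntegralAbs α f x = ∞ := not_lt_top_iff.1 htop
  simp only [Pi.mul_apply] at hx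
  rw [htop', ENNReal.top_mul hu', ENNReal.top_mul hv'] at hx
  exact lt_irrefl _ hx

theorem enorm_fracIntegral_mul_le (α : ℝ) (f : Fin m → EuclideanSpace ℝ (Fin n) → ℝ)
    {u v : EuclideanSpace ℝ (Fin n) → ℝ} (hu0 : ∀ x, 0 ≤ u x) (hv0 : ∀ x, 0 ≤ v x)
    (x : EuclideanSpace ℝ (Fin n)) :
    ‖fracIntegral α f x * u x * v x‖ₑ ≤
      fracIntegralAbs α f x * ENNReal.ofReal (u x) * ENNReal.ofReal (v x) := by
  rw [enorm_mul, enorm_mul, Real.enorm_of_nonneg (hu0 x), Real.enorm_of_nonneg (hv0 x)]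
  gcongr
  exact enorm_integral_le_lintegral_enorm _

theorem integrable_fracIntegral_mul {α : ℝ} {f : Fin m → EuclideanSpace ℝ (Fin n) → ℝ}
    (hf : ∀ i, AEMeasurable (f i) volume) {u v : EuclideanSpace ℝ (Fin n) → ℝ}
    (hu : AEMeasurable u volume) (hu0 : ∀ x, 0 ≤ u x) (hv : AEMeasurable v volume)
    (hv0 : ∀ x, 0 ≤ v x)
    (hfin : ∫⁻ x, fracIntegralAbs α f x * ENNReal.ofReal (u x) * ENNReal.ofReal (v x) ≠ ∞) :
    Integrable fun x => fracIntegral α f x * u x * v x := by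
  have hI : AEStronglyMeasurable (fracIntegral α f) volume :=
    (aemeasurable_uncurry_fracIntegrand α hf).aestronglyMeasurable.integral_prod_right'
  refine ⟨(hI.mul hu.aestronglyMeasurable).mul hv.aestronglyMeasurable, ?_⟩
  exact (lintegral_mono fun x => enorm_fracIntegral_mul_le α f hu0 hv0 x).trans_lt hfin.lt_top

end Final

open MultiFrac in
theorem mainTheorem7 (n m : ℕ) (α : ℝ) (hα : 0 < α) (hαnm : α < n * m)
    (v : EuclideanSpace ℝ (Fin n) → ℝ) (hv : IsWeight v) (hRH : RHInfty v) :
    ∃ C : ℝ≥0, 0 < C ∧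
      ∀ (w : Fin m → EuclideanSpace ℝ (Fin n) → ℝ) (f : Fin m → EuclideanSpace ℝ (Fin n) → ℝ),
        (∀ i, IsWeight (w i)) → (∀ i, AEMeasurable (f i) volume) →
        (∫⁻ x, fracIntegralAbs α f x * ENNReal.ofReal (geomMean w x) * ENNReal.ofReal (v x) ≤
          C * ∫⁻ x, fracMaximal α f x * hlMaximal (geomMean w) x * ENNReal.ofReal (v x)) ∧
        (∫⁻ x, fracMaximal α f x * hlMaximal (geomMean w) x * ENNReal.ofReal (v x) ≠ ∞ →
          (∀ᵐ x, geomMean w x * v x ≠ 0 → Integrable (fracIntegrand α f x)) ∧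
          Integrable (fun x => fracIntegral α f x * geomMean w x * v x) ∧
          ∫ x, fracIntegral α f x * geomMean w x * v x ≤
            C * (∫⁻ x, fracMaximal α f x * hlMaximal (geomMean w) x *
              ENNReal.ofReal (v x)).toReal) := by
  have hnm : (0 : ℝ) < n * m := hα.trans hαnm
  have hn : 0 < n := Nat.pos_of_ne_zero fun h => by simp [h] at hnm
  have hm : 0 < m := Nat.pos_of_ne_zero fun h => by simp [h] at hnm
  obtain ⟨K, hK1, hK, hD⟩ := DyadicRHInfty.of_rhInfty hRH
  set D : ℝ≥0∞ := ENNReal.ofReal (6 ^ ((m : ℝ) * n - α)) * dominationConst n m α K with hDdef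
  have hDtop : D ≠ ∞ := by
    have h₁ := levelRatio_ne_top n m hK
    have h₂ := geomConst_ne_top hα
    rw [hDdef, dominationConst]
    finiteness
  have hDC : D ≤ ((D.toNNReal + 1 : ℝ≥0) : ℝ≥0∞) := by
    rw [ENNReal.coe_add, ENNReal.coe_toNNReal hDtop]; exact le_self_add
  refine ⟨D.toNNReal + 1, by positivity, fun w f hw hf => ?_⟩
  have hu := aemeasurable_geomMean hw
  have hu0 := geomMean_nonneg hw
  set R := ∫⁻ x, fracMaximal α f x * hlMaximal (geomMean w) x * ENNReal.ofReal (v x) with hR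
  have main : ∫⁻ x, fracIntegralAbs α f x * ENNReal.ofReal (geomMean w x) *
      ENNReal.ofReal (v x) ≤ ((D.toNNReal + 1 : ℝ≥0) : ℝ≥0∞) * R := by
    -- The constant is positive thanks to the `+ 1`, so an infinite right-hand side makes the bound
    -- trivial.
    rcases eq_or_ne R ∞ with htop | hfin
    · rw [htop, ENNReal.mul_top (by simp)]; exact le_top
    · exact (lintegral_fracIntegralAbs_mul_le hn hm hαnm hK1 hK hv.aemeasurable hD hu hu0 hf
        hfin).trans (mul_le_mul_left hDC _)
  refine ⟨main, fun hfin => ?_⟩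
  have hCR := ENNReal.mul_ne_top (ENNReal.coe_ne_top (r := D.toNNReal + 1)) hfin
  have hlhs := ne_top_of_le_ne_top hCR main
  refine ⟨ae_integrable_fracIntegrand hf hu hu0 hv.aemeasurable hv.nonneg hlhs,
    integrable_fracIntegral_mul hf hu hu0 hv.aemeasurable hv.nonneg hlhs, ?_⟩
  refine (Real.le_norm_self _).trans ?_
  rw [← toReal_enorm, ← ENNReal.coe_toReal, ← ENNReal.toReal_mul]
  refine ENNReal.toReal_mono hCR ?_
  refine (enorm_integral_le_lintegral_enorm _).trans (le_trans ?_ main)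
  exact lintegral_mono fun x => enorm_fracIntegral_mul_le α f hu0 hv.nonneg x
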